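/- Let $|\alpha\rangle$ and $|\beta\rangle$ be normalised pure bipartite states of finite-dimensional systems, with ordered Schmidt vectors $\vec\alpha=(\alpha_1\ge\dots\ge\alpha_n)$ and $\vec\beta=(\beta_1\ge\dots\ge\beta_n)$ (probability vectors of the same length $n$, the squared Schmidt coefficients), and assume $\beta_n>0$. For pure bipartite states let $P_S(\psi\to\varphi)$ be the optimal probability (supremum) with which a protocol of finitely many rounds of local operations and classical communication converts $\psi$ into $\varphi$. Put $E_k(\vec v)=1-\sum_{l=1}^{k-1}v_l$. Suppose that $$P_S(|\alpha\rangle\to|\beta\rangle)<\min\{\alpha_n/\beta_n,\,1\},$$ and let $$L=\Big\{\,l\in\mathbb N:\ 1<l<n,\ P_S(|\alpha\rangle\to|\beta\rangle)=\frac{E_l(\vec\alpha)}{E_l(\vec\beta)}\Big\}.$$ Then $|\alpha\rangle$ is a probabilistic self-catalyst for the conversion, that is, $$P_S(|\alpha\rangle\otimes|\alpha\rangle\to|\beta\rangle\otimes|\alpha\rangle)>P_S(|\alpha\rangle\to|\beta\rangle)$$ (the tensor products being bipartite with respect to the same two parties), if and only if for all $r_1,\dots,r_n\in L\cup\{n+1\}$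 with $r_1\ge r_2\ge\dots\ge r_n\ne n+1$ there exist $i$ and $j$ with $1\le j<i\le n$ such that $$\frac{\alpha_i}{\alpha_j}<\frac{\beta_{r_j}}{\beta_{r_i-1}}\qquad\text{or}\qquad\frac{\alpha_i}{\alpha_j}>\frac{\beta_{r_j-1}}{\beta_{r_i}}.$$ Here an inequality in which the entry $\beta_{n+1}$ occurs is regarded as violated (so the first inequality is violated if $r_j=n+1$, and the second if $r_i=n+1$). -/

import Mathlib

open scoped Matrix Kronecker

/-- A pure bipartite state of `ℂ^a ⊗ ℂ^b` is given by its coefficient matrix `ψ`, that is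
`|ψ⟩ = ∑ i j, ψ i j |i⟩ ⊗ |j⟩`.  It may be unnormalised, and `weight ψ = ⟨ψ|ψ⟩`. -/
noncomputable def weight {a b : ℕ} (ψ : Matrix (Fin a) (Fin b) ℂ) : ℝ :=
  ∑ i, ∑ j, ‖ψ i j‖ ^ 2

/-- `|ψ⟩ ⊗ |χ⟩`, bipartite with respect to the cut `AA' : BB'`. -/
def tensorState {a b a' b' : ℕ} (ψ : Matrix (Fin a) (Fin b) ℂ) (χ : Matrix (Fin a') (Fin b') ℂ) :
    Matrix (Fin (a * a')) (Fin (b * b')) ℂ :=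
  Matrix.reindex finProdFinEquiv finProdFinEquiv (ψ ⊗ₖ χ)

/-- `LOCCReaches φ ψ p`: some finite protocol of local operations and classical communication,
run on the (possibly unnormalised) state `ψ`, ends in the target state `φ` with total
probability `p`.

A protocol is a finite tree.  At each node it stops without success (`fail`), or stops with
success because the current conditional state is a multiple of `φ` (`done`), or one of the parties
performs a measurement with finitely many outcomes, given by Kraus operators `K i` with
`∑ i, (K i)ᴴ * K i = 1`, whose output spaces may have any finite dimension (so that local
ancillas, isometries and the discarding of subsystems are included), and the rest of the protocol
depends on the outcome, which is communicated to the other party.  The states carried along are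
unnormalised, the squared norm of a state being the probability of the branch that leads to it. -/
inductive LOCCReaches {c d : ℕ} (φ : Matrix (Fin c) (Fin d) ℂ) :
    {a b : ℕ} → Matrix (Fin a) (Fin b) ℂ → ℝ → Prop
  | fail {a b : ℕ} (ψ : Matrix (Fin a) (Fin b) ℂ) : LOCCReaches φ ψ 0
  | done (z : ℂ) : LOCCReaches φ (z • φ) (weight (z • φ))
  | alice {a b : ℕ} (ψ : Matrix (Fin a) (Fin b) ℂ) (m : ℕ) (a' : Fin m → ℕ)
      (K : (i : Fin m) → Matrix (Fin (a' i)) (Fin a) ℂ) (hK : ∑ i, (K i)ᴴ * K i = 1)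
      (p : Fin m → ℝ) (h : ∀ i, LOCCReaches φ (K i * ψ) (p i)) :
      LOCCReaches φ ψ (∑ i, p i)
  | bob {a b : ℕ} (ψ : Matrix (Fin a) (Fin b) ℂ) (m : ℕ) (b' : Fin m → ℕ)
      (K : (i : Fin m) → Matrix (Fin (b' i)) (Fin b) ℂ) (hK : ∑ i, (K i)ᴴ * K i = 1)
      (p : Fin m → ℝ) (h : ∀ i, LOCCReaches φ (ψ * (K i)ᵀ) (p i)) :
      LOCCReaches φ ψ (∑ i, p i)

/-- The optimal probability `P_S(ψ → φ)` of the stochastic conversion of `ψ` into `φ` by local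
operations and classical communication (SLOCC), for normalised `ψ` and `φ`. -/
noncomputable def sloccProb {a b c d : ℕ} (ψ : Matrix (Fin a) (Fin b) ℂ)
    (φ : Matrix (Fin c) (Fin d) ℂ) : ℝ :=
  sSup {p : ℝ | LOCCReaches φ ψ p}

/-- `v` is the ordered Schmidt vector, with `n` entries, of the bipartite state `ψ`:
`v` is a non-increasing probability vector and `|ψ⟩ = ∑ s, √(v s) |e s⟩ ⊗ |f s⟩` for
orthonormal families `e` and `f` (the columns of `U` and `V`). -/
structure IsSchmidtVector {a b n : ℕ} (ψ : Matrix (Fin a) (Fin b) ℂ) (v : Fin n → ℝ) : Prop where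
  antitone : Antitone v
  nonneg : ∀ s, 0 ≤ v s
  sum_eq_one : ∑ s, v s = 1
  decomposition : ∃ (U : Matrix (Fin a) (Fin n) ℂ) (V : Matrix (Fin b) (Fin n) ℂ),
    Uᴴ * U = 1 ∧ Vᴴ * V = 1 ∧ ψ = U * Matrix.diagonal (fun s => ((√(v s) : ℝ) : ℂ)) * Vᵀ

/-- The entry `v_k` in the numbering `v = (v_1, …, v_n)`; it is `0` for other indices. -/
def entry {n : ℕ} (v : Fin n → ℝ) (k : ℕ) : ℝ :=
  if h : 1 ≤ k ∧ k ≤ n then v ⟨k - 1, by omega⟩ else 0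

/-- `E_k(v) = 1 - (v_1 + ⋯ + v_{k-1})`. -/
def tailSum {n : ℕ} (v : Fin n → ℝ) (k : ℕ) : ℝ :=
  1 - ∑ l ∈ Finset.Ico 1 k, entry v l

/-!
The conversion probabilities are governed by sums of smallest Schmidt weights (Vidal's theorem,
`loccReaches_iff`): `ψ → φ` succeeds with probability `p` if and only if, for every `m`, `p` times
the sum of the `m` smallest weights of `φ` is at most the sum of the `m` smallest weights of `ψ`.

* Upper bound. The sum of the smallest weights is the squared Frobenius distance to the matrices of
  bounded rank (`HasSchmidtWeights.le_weight_sub`, `HasSchmidtWeights.exists_rank_le`). Kraus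
  operators do not increase the rank, so this distance does not grow on average under local
  measurements (`LOCCReaches.mul_le_weight_sub`).
* Achievability. If the tail sums of `x` dominate those of `p • w`, a separation argument shows that
  `x` dominates entrywise a convex combination of permutations of `p • w`
  (`TailDominates.exists_convexHull_le`). A measurement diagonal in the Schmidt basis splits `x`
  accordingly (`LOCCReaches.diagState_add`), and local isometries turn each permuted copy of `w`
  into the target.

Let `P` be the optimal probability for `α → β`. By `lt_sloccProb_iff`, self-catalysis fails if and
only if some nonempty set `S` of products `α i * α j` has a sum at most `P` times every sum of
`S.card` products `β i * α j`. One may take `S` to consist of smallest products and to be an upper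
set, that is a staircase with columns `{i | r j ≤ i}`, `r` non-increasing. Its sum is
`∑ j, α j * E_{r j}(α) ≥ P * ∑ j, α j * E_{r j}(β)`, so the failure forces equality in every column,
which says `r j ∈ L ∪ {n + 1}`, and it forces the same staircase to consist of smallest products
`β i * α j`. Comparing the corners of two columns, the latter says that neither of the two
inequalities in the statement holds for any `j < i`. Conversely every staircase with these two
properties yields equality, hence failure.
-/

/-! ### The squared norm and local measurements -/

theorem weight_eq_trace {a b : ℕ} (ψ : Matrix (Fin a) (Fin b) ℂ) :
    ((weight ψ : ℝ) : ℂ) = (ψᴴ * ψ).trace := by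
  simp only [weight, Matrix.trace, Matrix.diag_apply, Matrix.mul_apply,
    Matrix.conjTranspose_apply]
  push_cast
  rw [Finset.sum_comm]
  simp [Complex.conj_mul']

theorem weight_nonneg {a b : ℕ} (ψ : Matrix (Fin a) (Fin b) ℂ) : 0 ≤ weight ψ :=
  Finset.sum_nonneg fun _ _ => Finset.sum_nonneg fun _ _ => sq_nonneg _

theorem weight_transpose {a b : ℕ} (ψ : Matrix (Fin a) (Fin b) ℂ) : weight ψᵀ = weight ψ := by
  simp only [weight, Matrix.transpose_apply]
  exact Finset.sum_comm

theorem weight_smul {a b : ℕ} (z : ℂ) (ψ : Matrix (Fin a) (Fin b) ℂ) :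
    weight (z • ψ) = ‖z‖ ^ 2 * weight ψ := by
  simp [weight, Finset.mul_sum, mul_pow]

theorem weight_diagonal {N : ℕ} (v : Fin N → ℂ) :
    weight (Matrix.diagonal v) = ∑ s, ‖v s‖ ^ 2 := by
  refine Finset.sum_congr rfl fun i _ => ?_
  rw [Finset.sum_eq_single i]
  · simp
  · intro j _ hj
    simp [Matrix.diagonal_apply_ne _ hj.symm]
  · simp

theorem sum_weight_kraus_mul {a b m : ℕ} {a' : Fin m → ℕ}
    (K : (i : Fin m) → Matrix (Fin (a' i)) (Fin a) ℂ) (hK : ∑ i, (K i)ᴴ * K i = 1)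
    (ψ : Matrix (Fin a) (Fin b) ℂ) : ∑ i, weight (K i * ψ) = weight ψ := by
  apply Complex.ofReal_injective
  push_cast
  simp only [weight_eq_trace, Matrix.conjTranspose_mul]
  calc ∑ i, (ψᴴ * (K i)ᴴ * (K i * ψ)).trace
      = (ψᴴ * (∑ i, (K i)ᴴ * K i) * ψ).trace := by
        rw [Matrix.mul_sum, Matrix.sum_mul, Matrix.trace_sum]
        simp only [Matrix.mul_assoc]
    _ = _ := by rw [hK, Matrix.mul_one]

theorem sum_weight_mul_kraus {a b m : ℕ} {b' : Fin m → ℕ}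
    (K : (i : Fin m) → Matrix (Fin (b' i)) (Fin b) ℂ) (hK : ∑ i, (K i)ᴴ * K i = 1)
    (ψ : Matrix (Fin a) (Fin b) ℂ) : ∑ i, weight (ψ * (K i)ᵀ) = weight ψ := by
  rw [← weight_transpose ψ, ← sum_weight_kraus_mul K hK ψᵀ]
  refine Finset.sum_congr rfl fun i _ => ?_
  rw [← weight_transpose, Matrix.transpose_mul, Matrix.transpose_transpose]

theorem weight_isometry_mul {a b c : ℕ} {U : Matrix (Fin c) (Fin a) ℂ} (hU : Uᴴ * U = 1)
    (ψ : Matrix (Fin a) (Fin b) ℂ) : weight (U * ψ) = weight ψ := by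
  simpa using sum_weight_kraus_mul (m := 1) (fun _ => U) (by simpa using hU) ψ

theorem weight_mul_isometry {a b c : ℕ} {V : Matrix (Fin c) (Fin b) ℂ} (hV : Vᴴ * V = 1)
    (ψ : Matrix (Fin a) (Fin b) ℂ) : weight (ψ * Vᵀ) = weight ψ := by
  simpa using sum_weight_mul_kraus (m := 1) (fun _ => V) (by simpa using hV) ψ

/-- The Kraus operators of the measurement that asks whether a vector lies in the range of the
isometry `U`: for the answer yes the isometry is undone. -/
def rangeKraus {a N : ℕ} (U : Matrix (Fin a) (Fin N) ℂ) :
    (i : Fin 2) → Matrix (Fin (![N, a] i)) (Fin a) ℂ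
  | 0 => Uᴴ
  | 1 => (1 - U * Uᴴ : Matrix (Fin a) (Fin a) ℂ)

theorem rangeKraus_complete {a N : ℕ} {U : Matrix (Fin a) (Fin N) ℂ} (hU : Uᴴ * U = 1) :
    ∑ i, (rangeKraus U i)ᴴ * rangeKraus U i = 1 := by
  have h : U * Uᴴ * (U * Uᴴ) = U * Uᴴ := by
    rw [Matrix.mul_assoc, ← Matrix.mul_assoc Uᴴ, hU, Matrix.one_mul]
  have h2 : Uᴴᴴ * Uᴴ + (1 - U * Uᴴ)ᴴ * (1 - U * Uᴴ) = 1 := by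
    simp only [Matrix.conjTranspose_sub, Matrix.conjTranspose_one, Matrix.conjTranspose_mul,
      Matrix.conjTranspose_conjTranspose, Matrix.sub_mul, Matrix.mul_sub, Matrix.one_mul,
      Matrix.mul_one, h]
    abel
  rw [Fin.sum_univ_two]
  exact h2

theorem weight_mul_conjTranspose_le {a b N : ℕ} {V : Matrix (Fin b) (Fin N) ℂ} (hV : Vᴴ * V = 1)
    (ψ : Matrix (Fin a) (Fin b) ℂ) : weight (ψ * (Vᴴ)ᵀ) ≤ weight ψ := by
  rw [← sum_weight_mul_kraus (rangeKraus V) (rangeKraus_complete hV) ψ, Fin.sum_univ_two]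
  exact le_add_of_nonneg_right (weight_nonneg _)

/-! ### Distance to the matrices of bounded rank as an LOCC monotone -/

/-- The squared Frobenius distance to the matrices of rank at most `k` does not increase on average
in a local measurement, since a Kraus operator maps a matrix of rank at most `k` to another one.
Hence `p` times this distance for the target is at most the distance for the initial state. -/
theorem LOCCReaches.mul_le_weight_sub {c d k : ℕ} {φ : Matrix (Fin c) (Fin d) ℂ} {C : ℝ}
    (hφ : weight φ = 1) (hC : ∀ Y : Matrix (Fin c) (Fin d) ℂ, Y.rank ≤ k → C ≤ weight (φ - Y))
    {a b : ℕ} {ψ : Matrix (Fin a) (Fin b) ℂ} {p : ℝ} (h : LOCCReaches φ ψ p) :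
    ∀ X : Matrix (Fin a) (Fin b) ℂ, X.rank ≤ k → p * C ≤ weight (ψ - X) := by
  induction h with
  | fail ψ => intro X _; simpa using weight_nonneg _
  | done z =>
    intro X hX
    rcases eq_or_ne z 0 with rfl | hz
    · rw [weight_smul]
      simpa using weight_nonneg _
    · have h1 : z • φ - X = z • (φ - z⁻¹ • X) := by
        rw [smul_sub, smul_smul, mul_inv_cancel₀ hz, one_smul]
      rw [h1, weight_smul, weight_smul, hφ, mul_one]
      refine mul_le_mul_of_nonneg_left (hC _ ?_) (sq_nonneg _)
      refine le_trans ?_ hX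
      have h2 : z⁻¹ • X = X * (z⁻¹ • (1 : Matrix (Fin d) (Fin d) ℂ)) := by
        rw [Matrix.mul_smul, Matrix.mul_one]
      rw [h2]
      exact Matrix.rank_mul_le_left _ _
  | alice ψ m a' K hK p h ih =>
    intro X hX
    rw [← sum_weight_kraus_mul K hK (ψ - X), Finset.sum_mul]
    refine Finset.sum_le_sum fun i _ => ?_
    rw [Matrix.mul_sub]
    exact ih i _ ((Matrix.rank_mul_le_right _ _).trans hX)
  | bob ψ m b' K hK p h ih =>
    intro X hX
    rw [← sum_weight_mul_kraus K hK (ψ - X), Finset.sum_mul]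
    refine Finset.sum_le_sum fun i _ => ?_
    rw [Matrix.sub_mul]
    exact ih i _ ((Matrix.rank_mul_le_left _ _).trans hX)

theorem LOCCReaches.nonneg {c d : ℕ} {φ : Matrix (Fin c) (Fin d) ℂ} {a b : ℕ}
    {ψ : Matrix (Fin a) (Fin b) ℂ} {p : ℝ} (h : LOCCReaches φ ψ p) : 0 ≤ p := by
  induction h with
  | fail ψ => exact le_rfl
  | done z => exact weight_nonneg _
  | alice ψ m a' K hK p h ih => exact Finset.sum_nonneg fun i _ => ih i
  | bob ψ m b' K hK p h ih => exact Finset.sum_nonneg fun i _ => ih i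

/-! ### Schmidt weights -/

/-- The weights `x` are the squared Schmidt coefficients of `ψ`, in no particular order and indexed
by any finite type; orthonormal Schmidt bases are the columns of two isometries. -/
def HasSchmidtWeights {ι : Type*} [Fintype ι] [DecidableEq ι] {a b : ℕ}
    (ψ : Matrix (Fin a) (Fin b) ℂ) (x : ι → ℝ) : Prop :=
  (∀ s, 0 ≤ x s) ∧ ∃ (U : Matrix (Fin a) ι ℂ) (V : Matrix (Fin b) ι ℂ),
    Uᴴ * U = 1 ∧ Vᴴ * V = 1 ∧ ψ = U * Matrix.diagonal (fun s => ((√(x s) : ℝ) : ℂ)) * Vᵀ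

theorem IsSchmidtVector.hasSchmidtWeights {a b n : ℕ} {ψ : Matrix (Fin a) (Fin b) ℂ}
    {v : Fin n → ℝ} (h : IsSchmidtVector ψ v) : HasSchmidtWeights ψ v :=
  ⟨h.nonneg, h.decomposition⟩

section
variable {ι κ : Type*} [Fintype ι] [DecidableEq ι] [Fintype κ] [DecidableEq κ]

theorem HasSchmidtWeights.comp_equiv {a b : ℕ} {ψ : Matrix (Fin a) (Fin b) ℂ} {x : ι → ℝ}
    (h : HasSchmidtWeights ψ x) (e : κ ≃ ι) : HasSchmidtWeights ψ (x ∘ e) := by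
  obtain ⟨h0, U, V, hU, hV, rfl⟩ := h
  refine ⟨fun s => h0 _, U.submatrix id e, V.submatrix id e, ?_, ?_, ?_⟩
  · rw [Matrix.conjTranspose_submatrix, ← Matrix.submatrix_mul _ _ _ id _ Function.bijective_id, hU]
    simp
  · rw [Matrix.conjTranspose_submatrix, ← Matrix.submatrix_mul _ _ _ id _ Function.bijective_id, hV]
    simp
  · have hd : Matrix.diagonal (fun s => ((√((x ∘ e) s) : ℝ) : ℂ)) =
        (Matrix.diagonal (fun s => ((√(x s) : ℝ) : ℂ))).submatrix e e := by
      rw [Matrix.submatrix_diagonal_equiv]; rfl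
    rw [hd, Matrix.submatrix_mul_equiv, Matrix.transpose_submatrix, Matrix.submatrix_mul_equiv]
    simp

theorem HasSchmidtWeights.tensorState {a b a' b' : ℕ} {ψ : Matrix (Fin a) (Fin b) ℂ}
    {χ : Matrix (Fin a') (Fin b') ℂ} {x : ι → ℝ} {y : κ → ℝ}
    (hψ : HasSchmidtWeights ψ x) (hχ : HasSchmidtWeights χ y) :
    HasSchmidtWeights (tensorState ψ χ) (fun s : ι × κ => x s.1 * y s.2) := by
  obtain ⟨hx, U, V, hU, hV, rfl⟩ := hψ
  obtain ⟨hy, U', V', hU', hV', rfl⟩ := hχ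
  have key : ∀ {c c' : ℕ} (A : Matrix (Fin c) ι ℂ) (B : Matrix (Fin c') κ ℂ), Aᴴ * A = 1 →
      Bᴴ * B = 1 → ((A ⊗ₖ B).submatrix (finProdFinEquiv (m := c) (n := c')).symm id)ᴴ *
        (A ⊗ₖ B).submatrix finProdFinEquiv.symm id = 1 := by
    intro c c' A B hA hB
    rw [Matrix.conjTranspose_submatrix, Matrix.submatrix_mul_equiv, Matrix.conjTranspose_kronecker,
      ← Matrix.mul_kronecker_mul, hA, hB]
    simp
  refine ⟨fun s => mul_nonneg (hx _) (hy _), _, _, key U U' hU hU', key V V' hV hV', ?_⟩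
  have hd : Matrix.diagonal (fun s : ι × κ => ((√(x s.1 * y s.2) : ℝ) : ℂ)) =
      Matrix.diagonal (fun s => ((√(x s) : ℝ) : ℂ)) ⊗ₖ
        Matrix.diagonal (fun s => ((√(y s) : ℝ) : ℂ)) := by
    rw [Matrix.diagonal_kronecker_diagonal]
    congr 1
    ext s
    rw [Real.sqrt_mul (hx _)]
    push_cast
    rfl
  rw [hd]
  simp only [_root_.tensorState, Matrix.reindex_apply, Matrix.mul_kronecker_mul,
    Matrix.transpose_submatrix, ← Matrix.kroneckerMap_transpose]
  ext i j
  simp [Matrix.mul_apply]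

end

/-! ### Smallest entries and the upper bound on the conversion probability -/

/-- For every size, the smallest entries of `p • w` add up to no more than the smallest entries
of `x`: the form by subsets of `p * E_k(w) ≤ E_k(x)` for all `k`, without reference to an ordering. -/
def TailDominates {ι : Type*} (x w : ι → ℝ) (p : ℝ) : Prop :=
  ∀ S : Finset ι, ∃ T : Finset ι, T.card = S.card ∧ p * ∑ s ∈ T, w s ≤ ∑ s ∈ S, x s

theorem TailDominates.comp_equiv {ι κ : Type*} {x w : ι → ℝ} {p : ℝ} (h : TailDominates x w p)
    (e : κ ≃ ι) : TailDominates (x ∘ e) (w ∘ e) p := by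
  intro S
  obtain ⟨T, hT, hle⟩ := h (S.map e.toEmbedding)
  refine ⟨T.map e.symm.toEmbedding, by simpa using hT, ?_⟩
  simpa using hle

section
variable {ι : Type*} [Fintype ι] [DecidableEq ι]

/-- A distance form of the Eckart–Young theorem: if `W` is the range of `A`, the coefficient of
`x s` is the squared distance of the `s`-th Schmidt vector to `W`. -/
theorem exists_coeff_sum_le_weight_sub {a N : ℕ} {U : Matrix (Fin a) (Fin N) ℂ}
    (hU : Uᴴ * U = 1) {x : Fin N → ℝ} (hx : ∀ s, 0 ≤ x s) (A : Matrix (Fin a) (Fin N) ℂ) :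
    ∃ c : Fin N → ℝ, (∀ s, 0 ≤ c s) ∧ (∀ s, c s ≤ 1) ∧ (N : ℝ) - A.rank ≤ ∑ s, c s ∧
      ∑ s, c s * x s ≤
        weight (U * Matrix.diagonal (fun s => ((√(x s) : ℝ) : ℂ)) - A) := by
  let u : Fin N → EuclideanSpace ℂ (Fin a) := fun s => WithLp.toLp 2 fun i => U i s
  let y : Fin N → EuclideanSpace ℂ (Fin a) := fun s => WithLp.toLp 2 fun i => A i s
  let W : Submodule ℂ (EuclideanSpace ℂ (Fin a)) :=
    (LinearMap.range A.mulVecLin).map (WithLp.linearEquiv 2 ℂ (Fin a → ℂ)).symm.toLinearMap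
  have hW : Module.finrank ℂ W = A.rank := LinearEquiv.finrank_map_eq _ _
  have hy : ∀ s, y s ∈ W := by
    intro s
    refine ⟨fun i => A i s, ⟨Pi.single s 1, ?_⟩, rfl⟩
    ext i
    simp
  have hu : Orthonormal ℂ u := by
    rw [orthonormal_iff_ite]
    intro s t
    have := congrFun (congrFun hU s) t
    rw [Matrix.mul_apply, Matrix.one_apply] at this
    rw [← this, PiLp.inner_apply]
    refine Finset.sum_congr rfl fun i _ => ?_
    simp [u, mul_comm]
  have hdist : ∀ s, ‖W.starProjection (u s)‖ ^ 2 + ‖Wᗮ.starProjection (u s)‖ ^ 2 = 1 := by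
    intro s
    rw [← Submodule.norm_sq_eq_add_norm_sq_starProjection, hu.1 s, one_pow]
  refine ⟨fun s => ‖Wᗮ.starProjection (u s)‖ ^ 2, fun s => sq_nonneg _, fun s => ?_, ?_, ?_⟩
  · have := hdist s
    nlinarith [sq_nonneg ‖W.starProjection (u s)‖]
  · have hsum : ∑ s, ‖W.starProjection (u s)‖ ^ 2 ≤ A.rank := by
      let f := stdOrthonormalBasis ℂ W
      have h1 : ∀ s, ‖W.starProjection (u s)‖ ^ 2 =
          ∑ t, ‖inner ℂ (u s) (f t : EuclideanSpace ℂ (Fin a))‖ ^ 2 := by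
        intro s
        have h2 : ‖W.starProjection (u s)‖ = ‖W.orthogonalProjectionOnto (u s)‖ := rfl
        rw [h2, ← f.sum_sq_norm_inner_right]
        refine Finset.sum_congr rfl fun t _ => ?_
        rw [Submodule.inner_orthogonalProjectionOnto_eq_of_mem_left, norm_inner_symm]
      simp only [h1]
      rw [Finset.sum_comm]
      -- Bessel's inequality, for each vector of an orthonormal basis of `W`
      calc _ ≤ ∑ t, (1 : ℝ) := by
            refine Finset.sum_le_sum fun t _ => ?_
            refine (hu.sum_inner_products_le (f t : EuclideanSpace ℂ (Fin a))).trans ?_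
            have := f.norm_eq_one t
            rw [← Submodule.coe_norm, this, one_pow]
        _ = _ := by simp [hW]
    have h3 : ∑ s, (‖W.starProjection (u s)‖ ^ 2 + ‖Wᗮ.starProjection (u s)‖ ^ 2) = N := by
      simp only [hdist]
      simp
    rw [Finset.sum_add_distrib] at h3
    linarith
  · have hw : weight (U * Matrix.diagonal (fun s => ((√(x s) : ℝ) : ℂ)) - A) =
        ∑ s, ‖((√(x s) : ℝ) : ℂ) • u s - y s‖ ^ 2 := by
      rw [weight, Finset.sum_comm]
      refine Finset.sum_congr rfl fun s _ => ?_
      rw [EuclideanSpace.norm_sq_eq]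
      refine Finset.sum_congr rfl fun i _ => ?_
      simp [u, y, Matrix.mul_diagonal, mul_comm]
    rw [hw]
    refine Finset.sum_le_sum fun s _ => ?_
    have h1 : Wᗮ.starProjection (((√(x s) : ℝ) : ℂ) • u s - y s) =
        ((√(x s) : ℝ) : ℂ) • Wᗮ.starProjection (u s) := by
      rw [map_sub, map_smul, (Submodule.starProjection_apply_eq_zero_iff Wᗮ (v := y s)).2, sub_zero]
      exact Submodule.le_orthogonal_orthogonal _ (hy s)
    have h2 := Wᗮ.norm_starProjection_apply_le (((√(x s) : ℝ) : ℂ) • u s - y s)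
    rw [h1, norm_smul, Complex.norm_real, Real.norm_of_nonneg (Real.sqrt_nonneg _)] at h2
    calc _ = (√(x s) * ‖Wᗮ.starProjection (u s)‖) ^ 2 := by
          rw [mul_pow, Real.sq_sqrt (hx s), mul_comm]
      _ ≤ _ := by gcongr

/-- `T` consists of smallest entries of the vector `w`. -/
def IsBottom (w : ι → ℝ) (T : Finset ι) : Prop := ∀ s ∈ T, ∀ t ∉ T, w s ≤ w t

/-- Linear optimisation over the hypersimplex: a fractional selection of total size at least
`T.card` weighs at least as much as the `T.card` smallest entries. -/
theorem IsBottom.sum_le_sum_mul {w : ι → ℝ} (hw : ∀ s, 0 ≤ w s) {T : Finset ι}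
    (hT : IsBottom w T) {c : ι → ℝ} (h0 : ∀ s, 0 ≤ c s) (h1 : ∀ s, c s ≤ 1)
    (hc : (T.card : ℝ) ≤ ∑ s, c s) : ∑ s ∈ T, w s ≤ ∑ s, c s * w s := by
  rcases T.eq_empty_or_nonempty with rfl | hne
  · simpa using Finset.sum_nonneg fun s _ => mul_nonneg (h0 s) (hw s)
  obtain ⟨m, hm, hmax⟩ := T.exists_max_image w hne
  have key : ∀ s, (c s - if s ∈ T then 1 else 0) * w m ≤
      (c s - if s ∈ T then 1 else 0) * w s := by
    intro s
    split_ifs with h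
    · nlinarith [hmax s h, h1 s]
    · nlinarith [hT m hm s h, h0 s]
  have hs := Finset.sum_le_sum fun s (_ : s ∈ Finset.univ) => key s
  rw [← Finset.sum_mul, Finset.sum_sub_distrib] at hs
  simp only [sub_mul, Finset.sum_sub_distrib, ite_mul, one_mul, zero_mul,
    Finset.sum_ite_mem, Finset.univ_inter, Finset.sum_const, nsmul_eq_mul, mul_one] at hs
  nlinarith [hw m, mul_nonneg (sub_nonneg.2 hc) (hw m)]

theorem IsBottom.sum_le_sum {w : ι → ℝ} (hw : ∀ s, 0 ≤ w s) {T : Finset ι} (hT : IsBottom w T)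
    {S : Finset ι} (hS : T.card = S.card) : ∑ s ∈ T, w s ≤ ∑ s ∈ S, w s := by
  have := hT.sum_le_sum_mul hw (c := fun s => if s ∈ S then 1 else 0)
    (fun s => by split_ifs <;> simp) (fun s => by split_ifs <;> simp) (by simp [hS])
  simpa using this

/-- The `m` elements with the smallest keys; a lexicographic key breaks ties. -/
theorem exists_card_eq_key_le {κ : Type*} [LinearOrder κ] (key : ι → κ) :
    ∀ m ≤ Fintype.card ι, ∃ T : Finset ι, T.card = m ∧ ∀ s ∈ T, ∀ t ∉ T, key s ≤ key t
  | 0, _ => ⟨∅, by simp⟩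
  | m + 1, hm => by
    obtain ⟨T, hT, hk⟩ := exists_card_eq_key_le key m (by omega)
    have hne : Tᶜ.Nonempty := by
      rw [← Finset.card_pos, Finset.card_compl]; omega
    obtain ⟨z, hz, hmin⟩ := Tᶜ.exists_min_image key hne
    rw [Finset.mem_compl] at hz
    refine ⟨insert z T, by rw [Finset.card_insert_of_notMem hz, hT], fun s hs t ht => ?_⟩
    rw [Finset.mem_insert, not_or] at ht
    rcases Finset.mem_insert.1 hs with rfl | hs
    · exact hmin t (by simpa using ht.2)
    · exact hk s hs t ht.2

theorem exists_isBottom (w : ι → ℝ) (S : Finset ι) :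
    ∃ T : Finset ι, T.card = S.card ∧ IsBottom w T :=
  exists_card_eq_key_le w _ S.card_le_univ

theorem HasSchmidtWeights.le_weight_sub {a b : ℕ} {φ : Matrix (Fin a) (Fin b) ℂ} {w : ι → ℝ}
    (hφ : HasSchmidtWeights φ w) {T : Finset ι} (hT : IsBottom w T)
    (Y : Matrix (Fin a) (Fin b) ℂ) (hY : Y.rank ≤ Fintype.card ι - T.card) :
    ∑ s ∈ T, w s ≤ weight (φ - Y) := by
  let e := (Fintype.equivFin ι).symm
  obtain ⟨h0, U, V, hU, hV, h⟩ := hφ.comp_equiv e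
  obtain ⟨c, hc0, hc1, hc, hle⟩ := exists_coeff_sum_le_weight_sub hU h0 (Y * (Vᴴ)ᵀ)
  have hV' : Vᵀ * (Vᴴ)ᵀ = 1 := by rw [← Matrix.transpose_mul, hV, Matrix.transpose_one]
  have h1 : U * Matrix.diagonal (fun s => ((√((w ∘ e) s) : ℝ) : ℂ)) - Y * (Vᴴ)ᵀ =
      (φ - Y) * (Vᴴ)ᵀ := by
    rw [Matrix.sub_mul, h, Matrix.mul_assoc _ Vᵀ, hV', Matrix.mul_one]
  rw [h1] at hle
  refine le_trans ?_ (hle.trans (weight_mul_conjTranspose_le hV _))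
  have hr : (Y * (Vᴴ)ᵀ).rank ≤ Fintype.card ι - T.card := (Matrix.rank_mul_le_left _ _).trans hY
  have hr' : (((Y * (Vᴴ)ᵀ).rank : ℕ) : ℝ) ≤ Fintype.card ι - T.card := by
    rw [← Nat.cast_sub T.card_le_univ]; exact_mod_cast hr
  rw [← Equiv.sum_comp e.symm (fun s => c s * (w ∘ e) s)]
  simp only [Function.comp_apply, Equiv.apply_symm_apply]
  refine hT.sum_le_sum_mul hφ.1 (fun s => hc0 _) (fun s => hc1 _) ?_
  rw [Equiv.sum_comp e.symm c]
  linarith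

/-- Discarding the Schmidt terms in `S` leaves a matrix of rank at most the number of other terms. -/
theorem HasSchmidtWeights.exists_rank_le {a b : ℕ} {ψ : Matrix (Fin a) (Fin b) ℂ} {x : ι → ℝ}
    (hψ : HasSchmidtWeights ψ x) (S : Finset ι) :
    ∃ X : Matrix (Fin a) (Fin b) ℂ, X.rank ≤ Fintype.card ι - S.card ∧
      weight (ψ - X) = ∑ s ∈ S, x s := by
  let e := (Fintype.equivFin ι).symm
  obtain ⟨h0, U, V, hU, hV, h⟩ := hψ.comp_equiv e
  let D (R : Finset ι) : Matrix (Fin (Fintype.card ι)) (Fin (Fintype.card ι)) ℂ :=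
    Matrix.diagonal fun s => if e s ∈ R then ((√(x (e s)) : ℝ) : ℂ) else 0
  have hD : Matrix.diagonal (fun s => ((√((x ∘ e) s) : ℝ) : ℂ)) - D Sᶜ = D S := by
    rw [Matrix.diagonal_sub]
    congr 1
    ext s
    by_cases hs : e s ∈ S <;> simp [hs]
  refine ⟨U * D Sᶜ * Vᵀ, ?_, ?_⟩
  · refine (Matrix.rank_mul_le_left _ _).trans ((Matrix.rank_mul_le_right _ _).trans ?_)
    rw [Matrix.rank_diagonal, ← Finset.card_compl, ← Fintype.card_coe]
    refine Fintype.card_le_of_injective (fun s => ⟨e s.1, ?_⟩) fun s t hst => ?_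
    · by_contra hs
      exact s.2 (if_neg hs)
    · exact Subtype.ext (e.injective (congrArg Subtype.val hst))
  · rw [h, ← Matrix.sub_mul, ← Matrix.mul_sub, hD, weight_mul_isometry hV, weight_isometry_mul hU,
      weight_diagonal]
    have : ∀ s, ‖if e s ∈ S then ((√(x (e s)) : ℝ) : ℂ) else 0‖ ^ 2 =
        if e s ∈ S then x (e s) else 0 := by
      intro s
      split_ifs
      · simp [Real.sq_sqrt (hψ.1 _)]
      · simp
    simp only [this]
    rw [Equiv.sum_comp e fun s => if s ∈ S then x s else 0]
    simp

theorem HasSchmidtWeights.weight_eq {a b : ℕ} {ψ : Matrix (Fin a) (Fin b) ℂ} {x : ι → ℝ}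
    (hψ : HasSchmidtWeights ψ x) : weight ψ = ∑ s, x s := by
  obtain ⟨h0, U, V, hU, hV, h⟩ := hψ.comp_equiv (Fintype.equivFin ι).symm
  rw [h, weight_mul_isometry hV, weight_isometry_mul hU, weight_diagonal,
    ← Equiv.sum_comp (Fintype.equivFin ι).symm x]
  refine Finset.sum_congr rfl fun s _ => ?_
  simp [Real.sq_sqrt (hψ.1 _)]

/-- The upper bound in Vidal's theorem. -/
theorem LOCCReaches.tailDominates {a b c d : ℕ} {ψ : Matrix (Fin a) (Fin b) ℂ}
    {φ : Matrix (Fin c) (Fin d) ℂ} {x w : ι → ℝ} (hψ : HasSchmidtWeights ψ x)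
    (hφ : HasSchmidtWeights φ w) (hw : ∑ s, w s = 1) {p : ℝ} (h : LOCCReaches φ ψ p) :
    TailDominates x w p := by
  intro S
  obtain ⟨T, hTS, hT⟩ := exists_isBottom w S
  obtain ⟨X, hX, hXS⟩ := hψ.exists_rank_le S
  refine ⟨T, hTS, hXS ▸ ?_⟩
  refine h.mul_le_weight_sub (by rw [hφ.weight_eq, hw]) (fun Y hY => ?_) X hX
  exact hφ.le_weight_sub hT Y (by rwa [hTS])

end

/-! ### Weak supermajorization and achievability -/

/-- Abel summation: a nonnegative non-decreasing weight is a nonnegative combination of the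
indicators of the final segments. -/
theorem sum_mul_nonneg_of_monotone : ∀ {N : ℕ} (g z : Fin N → ℝ), Monotone g → (∀ i, 0 ≤ g i) →
    (∀ l : Fin N, 0 ≤ ∑ i ∈ Finset.Ici l, z i) → 0 ≤ ∑ i, g i * z i
  | 0, _, _, _, _, _ => by simp
  | N + 1, g, z, hg, h0, hz => by
    have hr := sum_mul_nonneg_of_monotone (fun i : Fin N => g i.succ - g 0) (fun i => z i.succ)
      (fun i j hij => sub_le_sub_right (hg (Fin.succ_le_succ_iff.2 hij)) _)
      (fun i => sub_nonneg.2 (hg (Fin.zero_le _)))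
      (fun l => by
        have := hz l.succ
        rw [← Fin.map_succEmb_Ici, Finset.sum_map] at this
        simpa using this)
    have h1 : 0 ≤ ∑ i, z i := by
      have := hz 0
      rwa [show Finset.Ici (0 : Fin (N + 1)) = Finset.univ from Finset.Ici_bot] at this
    have h2 : ∑ i, g i * z i = g 0 * ∑ i, z i + ∑ i : Fin N, (g i.succ - g 0) * z i.succ := by
      rw [Fin.sum_univ_succ, Fin.sum_univ_succ z, mul_add, Finset.mul_sum, add_assoc,
        ← Finset.sum_add_distrib]
      congr 1
      exact Finset.sum_congr rfl fun i _ => by ring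
    rw [h2]
    exact add_nonneg (mul_nonneg (h0 0) h1) hr

/-- Weak supermajorization: if the smallest entries of `x` dominate those of `p • w`, then `x`
dominates entrywise a convex combination of permutations of `p • w`. -/
theorem TailDominates.exists_convexHull_le {N : ℕ} {x w : Fin N → ℝ} {p : ℝ} (hp : 0 ≤ p)
    (hw : ∀ s, 0 ≤ w s) (h : TailDominates x w p) :
    ∃ y ∈ convexHull ℝ (Set.range fun π : Equiv.Perm (Fin N) => p • (w ∘ π)), y ≤ x := by
  by_contra! hcon
  obtain ⟨f, u, v, hu, huv, hv⟩ := geometric_hahn_banach_compact_closed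
    (convex_convexHull ℝ (Set.range fun π : Equiv.Perm (Fin N) => p • (w ∘ π)))
    ((Set.finite_range _).isCompact_convexHull ℝ) (convex_Iic x) isClosed_Iic
    (Set.disjoint_left.2 fun y hy hyx => hcon y hy hyx)
  let g : Fin N → ℝ := fun s => -f (Pi.single s 1)
  have hf : ∀ y, f y = -∑ s, g s * y s := by
    intro y
    conv_lhs => rw [← Finset.univ_sum_single y]
    rw [map_sum, ← Finset.sum_neg_distrib]
    refine Finset.sum_congr rfl fun s _ => ?_
    have : (Pi.single s (y s) : Fin N → ℝ) = y s • Pi.single s 1 := by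
      rw [← Pi.single_smul, smul_eq_mul, mul_one]
    rw [this, map_smul, smul_eq_mul]
    ring
  -- the functional is bounded below on `Iic x`, so its coefficients have a sign
  have hg : ∀ s, 0 ≤ g s := by
    intro s
    by_contra! hs
    have hpos : 0 < f (Pi.single s 1) := by simpa [g] using hs
    obtain ⟨t, ht⟩ := exists_nat_gt ((f x - v) / f (Pi.single s 1))
    rw [div_lt_iff₀ hpos] at ht
    have := hv (x - (t : ℝ) • Pi.single s 1) (Set.mem_Iic.2 (sub_le_self _
      (smul_nonneg (Nat.cast_nonneg t) (Pi.single_nonneg.2 zero_le_one))))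
    rw [map_sub, map_smul, smul_eq_mul] at this
    linarith
  let σ := Tuple.sort g
  let ρ := Tuple.sort (fun s => -w s)
  have hρ : ∀ i j, i ≤ j → w (ρ j) ≤ w (ρ i) := fun i j hij => by
    simpa using Tuple.monotone_sort (fun s => -w s) hij
  have habel := sum_mul_nonneg_of_monotone (g ∘ σ) (fun i => x (σ i) - p * w (ρ i))
    (Tuple.monotone_sort g) (fun i => hg _) fun l => by
      obtain ⟨T, hT, hle⟩ := h ((Finset.Ici l).map σ.toEmbedding)
      have hB : IsBottom w ((Finset.Ici l).map ρ.toEmbedding) := by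
        intro s hs t ht
        obtain ⟨i, rfl⟩ := ρ.surjective s
        obtain ⟨j, rfl⟩ := ρ.surjective t
        simp only [Finset.mem_map_equiv, Equiv.symm_apply_apply, Finset.mem_Ici, not_le] at hs ht
        exact hρ _ _ (ht.le.trans hs)
      have h1 := hB.sum_le_sum hw (S := T) (by rw [hT, Finset.card_map, Finset.card_map])
      have h2 := mul_le_mul_of_nonneg_left h1 hp
      rw [Finset.sum_map] at h2 hle
      rw [Finset.sum_sub_distrib, ← Finset.mul_sum]
      simp only [Equiv.coe_toEmbedding] at h2 hle
      linarith
  -- pairing the largest coefficients with the smallest entries of `w` contradicts the separation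
  have h1 := hu _ (subset_convexHull ℝ _ ⟨σ.symm.trans ρ, rfl⟩)
  have h2 := hv x (Set.mem_Iic.2 le_rfl)
  rw [hf] at h1 h2
  rw [← Equiv.sum_comp σ] at h1 h2
  simp only [Function.comp_apply, Pi.smul_apply, smul_eq_mul, Equiv.trans_apply,
    Equiv.symm_apply_apply, mul_sub, Finset.sum_sub_distrib] at h1 h2 habel
  linarith

/-! ### Explicit protocols -/

theorem LOCCReaches.of_isometry_mul {a a' b c d : ℕ} {φ : Matrix (Fin c) (Fin d) ℂ}
    {ψ : Matrix (Fin a) (Fin b) ℂ} {U : Matrix (Fin a') (Fin a) ℂ} (hU : Uᴴ * U = 1) {p : ℝ}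
    (h : LOCCReaches φ (U * ψ) p) : LOCCReaches φ ψ p := by
  simpa using LOCCReaches.alice ψ 1 _ (fun _ => U) (by simpa using hU) (fun _ => p) fun _ => h

theorem LOCCReaches.of_mul_isometry {a b b' c d : ℕ} {φ : Matrix (Fin c) (Fin d) ℂ}
    {ψ : Matrix (Fin a) (Fin b) ℂ} {V : Matrix (Fin b') (Fin b) ℂ} (hV : Vᴴ * V = 1) {p : ℝ}
    (h : LOCCReaches φ (ψ * Vᵀ) p) : LOCCReaches φ ψ p := by
  simpa using LOCCReaches.bob ψ 1 _ (fun _ => V) (by simpa using hV) (fun _ => p) fun _ => h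

theorem LOCCReaches.isometry_mul {a a' b c d : ℕ} {φ : Matrix (Fin c) (Fin d) ℂ}
    {ψ : Matrix (Fin a) (Fin b) ℂ} {U : Matrix (Fin a') (Fin a) ℂ} (hU : Uᴴ * U = 1) {p : ℝ}
    (h : LOCCReaches φ ψ p) : LOCCReaches φ (U * ψ) p := by
  have := LOCCReaches.alice (φ := φ) (U * ψ) 2 _ (rangeKraus U) (rangeKraus_complete hU) ![p, 0]
    (Fin.forall_fin_two.2 ⟨?_, LOCCReaches.fail _⟩)
  · simpa using this
  · change LOCCReaches φ (Uᴴ * (U * ψ)) p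
    rwa [← Matrix.mul_assoc, hU, Matrix.one_mul]

theorem LOCCReaches.mul_isometry {a b b' c d : ℕ} {φ : Matrix (Fin c) (Fin d) ℂ}
    {ψ : Matrix (Fin a) (Fin b) ℂ} {V : Matrix (Fin b') (Fin b) ℂ} (hV : Vᴴ * V = 1) {p : ℝ}
    (h : LOCCReaches φ ψ p) : LOCCReaches φ (ψ * Vᵀ) p := by
  have := LOCCReaches.bob (φ := φ) (ψ * Vᵀ) 2 _ (rangeKraus V) (rangeKraus_complete hV) ![p, 0]
    (Fin.forall_fin_two.2 ⟨?_, LOCCReaches.fail _⟩)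
  · simpa using this
  · change LOCCReaches φ (ψ * Vᵀ * (Vᴴ)ᵀ) p
    rwa [Matrix.mul_assoc, ← Matrix.transpose_mul, hV, Matrix.transpose_one, Matrix.mul_one]

/-- The unnormalised state `∑ s, √(x s) |s⟩ ⊗ |s⟩`. -/
noncomputable def diagState {N : ℕ} (x : Fin N → ℝ) : Matrix (Fin N) (Fin N) ℂ :=
  Matrix.diagonal fun s => ((√(x s) : ℝ) : ℂ)

/-- A measurement of Alice that is diagonal in the Schmidt basis splits the Schmidt weights into
two summands. -/
theorem LOCCReaches.diagState_add {N c d : ℕ} {φ : Matrix (Fin c) (Fin d) ℂ} {y z : Fin N → ℝ}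
    (hy : 0 ≤ y) (hz : 0 ≤ z) {p q : ℝ} (hp : LOCCReaches φ (diagState y) p)
    (hq : LOCCReaches φ (diagState z) q) : LOCCReaches φ (diagState (y + z)) (p + q) := by
  -- where `y s + z s = 0` the quotients are `0`, and completeness requires the entry `1` instead
  let k : Fin N → ℝ := fun s => if y s + z s = 0 then 1 else √(y s / (y s + z s))
  let l : Fin N → ℝ := fun s => √(z s / (y s + z s))
  have hk : ∀ s, k s ^ 2 + l s ^ 2 = 1 := by
    intro s
    have hys := hy s
    have hzs := hz s
    simp only [Pi.zero_apply] at hys hzs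
    simp only [k, l]
    split_ifs with h
    · simp [h]
    · rw [Real.sq_sqrt (by positivity), Real.sq_sqrt (by positivity)]
      field_simp
  have hky : ∀ s, k s * √(y s + z s) = √(y s) := by
    intro s
    have hys := hy s
    have hzs := hz s
    simp only [Pi.zero_apply] at hys hzs
    simp only [k]
    split_ifs with h
    · rw [h, show y s = 0 by linarith]; simp
    · rw [← Real.sqrt_mul (by positivity), div_mul_cancel₀ _ h]
  have hlz : ∀ s, l s * √(y s + z s) = √(z s) := by
    intro s
    have hys := hy s
    have hzs := hz s
    simp only [Pi.zero_apply] at hys hzs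
    by_cases h : y s + z s = 0
    · rw [h, show z s = 0 by linarith]; simp
    · rw [← Real.sqrt_mul (by positivity), div_mul_cancel₀ _ h]
  have := LOCCReaches.alice (φ := φ) (diagState (y + z)) 2 (fun _ => N)
    ![Matrix.diagonal fun s => ((k s : ℝ) : ℂ), Matrix.diagonal fun s => ((l s : ℝ) : ℂ)] (by
      rw [Fin.sum_univ_two]
      simp only [Matrix.cons_val_zero, Matrix.cons_val_one, Matrix.diagonal_conjTranspose,
        Matrix.diagonal_mul_diagonal, Matrix.diagonal_add]
      rw [← Matrix.diagonal_one]
      congr 1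
      ext s
      have := hk s
      simp only [Pi.star_apply, RCLike.star_def, Complex.conj_ofReal]
      norm_cast
      rw [← this]
      ring) ![p, q] (Fin.forall_fin_two.2 ⟨?_, ?_⟩)
  · simpa using this
  · simp only [Matrix.cons_val_zero, diagState,
      Matrix.diagonal_mul_diagonal, Pi.add_apply, ← Complex.ofReal_mul, hky]
    exact hp
  · simp only [Matrix.cons_val_one, Matrix.cons_val_zero, diagState,
      Matrix.diagonal_mul_diagonal, Pi.add_apply, ← Complex.ofReal_mul, hlz]
    exact hq

/-- Local isometries turn `√t • ∑ s, √(w s) |s⟩ ⊗ |s⟩` into `√t • φ`, which is a success. -/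
theorem HasSchmidtWeights.reaches_diagState {N c d : ℕ} {φ : Matrix (Fin c) (Fin d) ℂ}
    {w : Fin N → ℝ} (hφ : HasSchmidtWeights φ w) (hw : ∑ s, w s = 1) {t : ℝ} (ht : 0 ≤ t) :
    LOCCReaches φ (diagState (t • w)) t := by
  have hn := hφ.weight_eq
  obtain ⟨h0, U, V, hU, hV, h⟩ := hφ
  have hd : diagState (t • w) =
      ((√t : ℝ) : ℂ) • Matrix.diagonal (fun s => ((√(w s) : ℝ) : ℂ)) := by
    rw [← Matrix.diagonal_smul]
    unfold diagState
    congr 1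
    ext s
    simp [Real.sqrt_mul ht]
  refine LOCCReaches.of_isometry_mul hU (LOCCReaches.of_mul_isometry hV ?_)
  rw [hd, Matrix.mul_smul, Matrix.smul_mul, ← h]
  have hz := LOCCReaches.done (φ := φ) ((√t : ℝ) : ℂ)
  rw [weight_smul, hn, hw] at hz
  simpa [Real.sq_sqrt ht] using hz

/-- Achievability in Vidal's theorem: the Schmidt weights of `ψ` are split into multiples of
permutations of those of `φ`, with total factor `p`, and a remainder that is given up. -/
theorem TailDominates.reaches {ι : Type*} [Fintype ι] [DecidableEq ι] {a b c d : ℕ}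
    {ψ : Matrix (Fin a) (Fin b) ℂ} {φ : Matrix (Fin c) (Fin d) ℂ} {x w : ι → ℝ}
    (hψ : HasSchmidtWeights ψ x) (hφ : HasSchmidtWeights φ w) (hw : ∑ s, w s = 1) {p : ℝ}
    (hp : 0 ≤ p) (h : TailDominates x w p) : LOCCReaches φ ψ p := by
  let e := (Fintype.equivFin ι).symm
  have hφe := hφ.comp_equiv e
  have hwe : ∑ s, (w ∘ e) s = 1 := by rw [← hw]; exact Equiv.sum_comp e w
  obtain ⟨h0, U, V, hU, hV, hdec⟩ := hψ.comp_equiv e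
  obtain ⟨y, hy, hyx⟩ := (h.comp_equiv e).exists_convexHull_le hp hφe.1
  -- weights all of whose multiples reach the target with probability proportional to `p`
  let C : Set (Fin (Fintype.card ι) → ℝ) :=
    {y | 0 ≤ y ∧ ∀ t : ℝ, 0 ≤ t → LOCCReaches φ (diagState (t • y)) (t * p)}
  have hC : Convex ℝ C := by
    intro y hy z hz r s hr hs hrs
    refine ⟨add_nonneg (smul_nonneg hr hy.1) (smul_nonneg hs hz.1), fun t ht => ?_⟩
    have := LOCCReaches.diagState_add (smul_nonneg (mul_nonneg ht hr) hy.1)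
      (smul_nonneg (mul_nonneg ht hs) hz.1) (hy.2 _ (mul_nonneg ht hr)) (hz.2 _ (mul_nonneg ht hs))
    rw [← add_mul, ← mul_add, hrs, mul_one] at this
    rwa [smul_add, smul_smul, smul_smul]
  have hyC : y ∈ C := by
    refine convexHull_min ?_ hC hy
    rintro _ ⟨π, rfl⟩
    refine ⟨smul_nonneg hp fun s => hφe.1 _, fun t ht => ?_⟩
    have := (hφe.comp_equiv π).reaches_diagState
      (by rw [← hwe]; exact Equiv.sum_comp π (w ∘ e)) (mul_nonneg ht hp)
    rwa [smul_smul]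
  have hx : LOCCReaches φ (diagState (x ∘ e)) p := by
    have h1 := hyC.2 1 zero_le_one
    rw [one_smul, one_mul] at h1
    have := LOCCReaches.diagState_add hyC.1 (sub_nonneg.2 hyx) h1 (LOCCReaches.fail _)
    rwa [add_sub_cancel, add_zero] at this
  rw [hdec]
  exact (hx.isometry_mul hU).mul_isometry hV

/-! ### The optimal conversion probability -/

/-- Vidal's theorem, with the optimal probability replaced by the set of all probabilities that
are attained. -/
theorem loccReaches_iff {ι : Type*} [Fintype ι] [DecidableEq ι] {a b c d : ℕ}
    {ψ : Matrix (Fin a) (Fin b) ℂ} {φ : Matrix (Fin c) (Fin d) ℂ} {x w : ι → ℝ}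
    (hψ : HasSchmidtWeights ψ x) (hφ : HasSchmidtWeights φ w) (hw : ∑ s, w s = 1) {p : ℝ} :
    LOCCReaches φ ψ p ↔ 0 ≤ p ∧ TailDominates x w p :=
  ⟨fun h => ⟨h.nonneg, h.tailDominates hψ hφ hw⟩, fun h => h.2.reaches hψ hφ hw h.1⟩

theorem bddAbove_loccReaches {ι : Type*} [Fintype ι] [DecidableEq ι] {a b c d : ℕ}
    {ψ : Matrix (Fin a) (Fin b) ℂ} {φ : Matrix (Fin c) (Fin d) ℂ} {x w : ι → ℝ}
    (hψ : HasSchmidtWeights ψ x) (hφ : HasSchmidtWeights φ w) (hw : ∑ s, w s = 1) :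
    BddAbove {p | LOCCReaches φ ψ p} := by
  refine ⟨∑ s, x s, fun p hp => ?_⟩
  obtain ⟨T, hT, hle⟩ := hp.tailDominates hψ hφ hw Finset.univ
  rw [(Finset.card_eq_iff_eq_univ T).1 (by rw [hT, Finset.card_univ]), hw, mul_one] at hle
  exact hle

/-- Since there are finitely many `S`, strict inequalities leave room for a larger probability. -/
theorem lt_sloccProb_iff {ι : Type*} [Fintype ι] [DecidableEq ι] [Nonempty ι] {a b c d : ℕ}
    {ψ : Matrix (Fin a) (Fin b) ℂ} {φ : Matrix (Fin c) (Fin d) ℂ} {x w : ι → ℝ}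
    (hψ : HasSchmidtWeights ψ x) (hφ : HasSchmidtWeights φ w) (hw : ∑ s, w s = 1)
    (hpos : ∀ s, 0 < w s) {P : ℝ} (hP : 0 ≤ P) :
    P < sloccProb ψ φ ↔ ∀ S : Finset ι, S.Nonempty →
      ∃ T : Finset ι, T.card = S.card ∧ P * ∑ s ∈ T, w s < ∑ s ∈ S, x s := by
  have hsum : ∀ {S T : Finset ι}, S.Nonempty → T.card = S.card → 0 < ∑ s ∈ T, w s :=
    fun hS hT => Finset.sum_pos (fun s _ => hpos s) (by rwa [← Finset.card_pos, hT, Finset.card_pos])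
  constructor
  · intro h S hS
    obtain ⟨p, hp, hPp⟩ := exists_lt_of_lt_csSup ⟨0, LOCCReaches.fail ψ⟩ h
    obtain ⟨T, hT, hle⟩ := hp.tailDominates hψ hφ hw S
    exact ⟨T, hT, (mul_lt_mul_of_pos_right hPp (hsum hS hT)).trans_le hle⟩
  · intro h
    choose! T hT hlt using h
    obtain ⟨S₀, hS₀, hmin⟩ := (Finset.univ.filter fun S : Finset ι => S.Nonempty).exists_min_image
      (fun S => (∑ s ∈ S, x s) / ∑ s ∈ T S, w s) ⟨Finset.univ, by simp⟩
    simp only [Finset.mem_filter, Finset.mem_univ, true_and] at hS₀ hmin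
    have hP0 : P < (∑ s ∈ S₀, x s) / ∑ s ∈ T S₀, w s := by
      rw [lt_div_iff₀ (hsum hS₀ (hT _ hS₀))]
      exact hlt _ hS₀
    refine hP0.trans_le (le_csSup (bddAbove_loccReaches hψ hφ hw) ?_)
    refine (loccReaches_iff hψ hφ hw).2 ⟨hP.trans hP0.le, fun S => ?_⟩
    rcases S.eq_empty_or_nonempty with rfl | hS
    · exact ⟨∅, rfl, by simp⟩
    · refine ⟨T S, hT S hS, ?_⟩
      rw [← le_div_iff₀ (hsum hS (hT S hS))]
      exact hmin S hS

/-! ### Tail sums of ordered Schmidt vectors -/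

theorem entry_val_add_one {n : ℕ} (v : Fin n → ℝ) (i : Fin n) : entry v (i + 1) = v i := by
  unfold entry
  rw [dif_pos ⟨Nat.le_add_left 1 _, i.2⟩]
  rfl

theorem tailSum_eq_sum {n : ℕ} {v : Fin n → ℝ} (hv : ∑ i, v i = 1) (k : ℕ) :
    tailSum v k =
      ∑ i ∈ Finset.univ.filter (fun i : Fin n => k ≤ (i : ℕ) + 1), v i := by
  have h1 : ∑ i ∈ Finset.univ.filter (fun i : Fin n => ¬ k ≤ (i : ℕ) + 1), v i =
      ∑ l ∈ Finset.Ico 1 k, entry v l := by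
    have hinj : Set.InjOn (fun i : Fin n => (i : ℕ) + 1)
        (Finset.univ.filter fun i : Fin n => ¬ k ≤ (i : ℕ) + 1) := fun i _ j _ hij =>
      Fin.ext (Nat.add_right_cancel hij)
    rw [← Finset.sum_subset (s₁ := (Finset.univ.filter fun i : Fin n =>
      ¬ k ≤ (i : ℕ) + 1).image fun i : Fin n => (i : ℕ) + 1), Finset.sum_image hinj]
    · simp only [entry_val_add_one]
    · intro l hl
      simp only [Finset.mem_image, Finset.mem_filter, Finset.mem_univ, true_and] at hl
      obtain ⟨i, hi, rfl⟩ := hl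
      simp only [Finset.mem_Ico]
      omega
    · intro l hl hl'
      simp only [Finset.mem_Ico] at hl
      unfold entry
      rw [dif_neg]
      intro hln
      refine hl' (Finset.mem_image.2 ⟨⟨l - 1, by omega⟩, ?_, by simp only; omega⟩)
      simp only [Finset.mem_filter, Finset.mem_univ, true_and]
      omega
  rw [tailSum, ← h1, ← hv, ← Finset.sum_filter_add_sum_filter_not Finset.univ
    (fun i : Fin n => k ≤ (i : ℕ) + 1)]
  ring

theorem tailSum_add_one {n : ℕ} {v : Fin n → ℝ} (hv : ∑ i, v i = 1) : tailSum v (n + 1) = 0 := by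
  rw [tailSum_eq_sum hv]
  refine Finset.sum_eq_zero fun i hi => ?_
  have := (Finset.mem_filter.1 hi).2
  omega

theorem tailSum_pos {n : ℕ} {v : Fin n → ℝ} (hv : ∑ i, v i = 1) (hpos : ∀ i, 0 < v i) {k : ℕ}
    (h1 : 1 ≤ k) (hk : k ≤ n) : 0 < tailSum v k := by
  rw [tailSum_eq_sum hv]
  refine Finset.sum_pos (fun i _ => hpos i) ⟨⟨k - 1, by omega⟩, ?_⟩
  simp only [Finset.mem_filter, Finset.mem_univ, true_and]
  omega

theorem tailSum_last {n : ℕ} {v : Fin n → ℝ} (hv : ∑ i, v i = 1) (hn : 1 ≤ n) :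
    tailSum v n = entry v n := by
  have hlast := entry_val_add_one v ⟨n - 1, by omega⟩
  simp only [Nat.sub_add_cancel hn] at hlast
  rw [tailSum_eq_sum hv, hlast]
  refine Finset.sum_eq_single_of_mem _ ?_ fun i hi hne => ?_
  · simp only [Finset.mem_filter, Finset.mem_univ, true_and]
    omega
  · have := (Finset.mem_filter.1 hi).2
    exact absurd (Fin.ext (by simp only; omega)) hne

theorem entry_le_of_antitone {n : ℕ} {v : Fin n → ℝ} (hv : Antitone v) {k l : ℕ} (hk : 1 ≤ k)
    (hkl : k ≤ l) (hl : l ≤ n) : entry v l ≤ entry v k := by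
  unfold entry
  rw [dif_pos ⟨hk.trans hkl, hl⟩, dif_pos ⟨hk, hkl.trans hl⟩]
  exact hv (Fin.mk_le_mk.2 (by omega))

theorem entry_pos {n : ℕ} {v : Fin n → ℝ} (hv : ∀ i, 0 < v i) {k : ℕ} (hk : 1 ≤ k) (hl : k ≤ n) :
    0 < entry v k := by
  unfold entry
  rw [dif_pos ⟨hk, hl⟩]
  exact hv _

theorem pos_of_entry_pos {n : ℕ} {v : Fin n → ℝ} (hv : Antitone v) (h : 0 < entry v n)
    (i : Fin n) : 0 < v i := by
  rw [← entry_val_add_one v i]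
  exact h.trans_le (entry_le_of_antitone hv (by omega) i.2 le_rfl)

theorem sloccProb_nonneg {a b c d : ℕ} (ψ : Matrix (Fin a) (Fin b) ℂ)
    (φ : Matrix (Fin c) (Fin d) ℂ) : 0 ≤ sloccProb ψ φ :=
  Real.sSup_nonneg fun _ hp => LOCCReaches.nonneg hp

/-- The upper bound passes to the supremum, so it is available without knowing that the optimal
probability is attained. -/
theorem sloccProb_mul_tailSum_le {a b c d n : ℕ} {ψ : Matrix (Fin a) (Fin b) ℂ}
    {φ : Matrix (Fin c) (Fin d) ℂ} {α β : Fin n → ℝ} (hα : IsSchmidtVector ψ α)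
    (hβ : IsSchmidtVector φ β) (hβpos : ∀ i, 0 < β i) {k : ℕ} (h1 : 1 ≤ k) (hk : k ≤ n) :
    sloccProb ψ φ * tailSum β k ≤ tailSum α k := by
  rw [← le_div_iff₀ (tailSum_pos hβ.sum_eq_one hβpos h1 hk)]
  refine csSup_le ⟨0, LOCCReaches.fail ψ⟩ fun p hp => ?_
  rw [le_div_iff₀ (tailSum_pos hβ.sum_eq_one hβpos h1 hk), tailSum_eq_sum hβ.sum_eq_one,
    tailSum_eq_sum hα.sum_eq_one]
  obtain ⟨T, hT, hle⟩ := LOCCReaches.tailDominates hα.hasSchmidtWeights hβ.hasSchmidtWeights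
    hβ.sum_eq_one hp (Finset.univ.filter fun i : Fin n => k ≤ (i : ℕ) + 1)
  refine le_trans (mul_le_mul_of_nonneg_left ?_ (LOCCReaches.nonneg hp)) hle
  refine IsBottom.sum_le_sum hβ.nonneg (fun s hs t ht => hβ.antitone ?_) hT.symm
  simp only [Finset.mem_filter, Finset.mem_univ, true_and] at hs ht
  exact Fin.le_def.2 (by omega)

/-! ### Staircases of smallest products -/

/-- The staircase region in the `n × n` square with columns `{i | r j ≤ i}`, in the numbering that
starts with `1`. -/
def staircase (n : ℕ) (r : ℕ → ℕ) : Finset (Fin n × Fin n) :=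
  Finset.univ.filter fun s => r (s.2 + 1) ≤ (s.1 : ℕ) + 1

theorem mem_staircase {n : ℕ} {r : ℕ → ℕ} {s : Fin n × Fin n} :
    s ∈ staircase n r ↔ r (s.2 + 1) ≤ (s.1 : ℕ) + 1 := by
  simp [staircase]

theorem sum_staircase {n : ℕ} {v : Fin n → ℝ} (hv : ∑ i, v i = 1) (α : Fin n → ℝ) (r : ℕ → ℕ) :
    ∑ s ∈ staircase n r, v s.1 * α s.2 = ∑ j : Fin n, α j * tailSum v (r (j + 1)) := by
  rw [staircase, Finset.sum_filter, Fintype.sum_prod_type_right]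
  refine Finset.sum_congr rfl fun j _ => ?_
  rw [tailSum_eq_sum hv, Finset.mul_sum, Finset.sum_filter]
  refine Finset.sum_congr rfl fun i _ => ?_
  split_ifs
  · exact mul_comm _ _
  · rfl

/-- In each column of a staircase the largest entry of `β i * α j` sits at the corner `r j`, and the
smallest entry outside sits just before it, so only these have to be compared. -/
theorem isBottom_staircase {n : ℕ} {α β : Fin n → ℝ} (hβ : Antitone β) (hα : ∀ i, 0 ≤ α i)
    {r : ℕ → ℕ} (h : ∀ j j' : Fin n, r (j + 1) ≤ n → 2 ≤ r (j' + 1) → r (j' + 1) ≤ n + 1 →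
      entry β (r (j + 1)) * α j ≤ entry β (r (j' + 1) - 1) * α j')
    (h2 : ∀ j : Fin n, 1 ≤ r (j + 1)) (hr : ∀ j : Fin n, r (j + 1) ≤ n + 1) :
    IsBottom (fun s : Fin n × Fin n => β s.1 * α s.2) (staircase n r) := by
  rintro ⟨i, j⟩ hs ⟨i', j'⟩ ht
  rw [mem_staircase] at hs ht
  simp only at hs ht ⊢
  have hi := i.2
  calc β i * α j ≤ entry β (r (j + 1)) * α j := by
        refine mul_le_mul_of_nonneg_right ?_ (hα j)
        rw [← entry_val_add_one β i]
        exact entry_le_of_antitone hβ (h2 j) hs (by omega)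
    _ ≤ entry β (r (j' + 1) - 1) * α j' := h j j' (by omega) (by omega) (hr j')
    _ ≤ β i' * α j' := by
        refine mul_le_mul_of_nonneg_right ?_ (hα j')
        rw [← entry_val_add_one β i']
        have := hr j'
        exact entry_le_of_antitone hβ (by omega) (by omega) (by omega)

/-- An upper set of the square is a staircase: `r j` is the first row from which on the column `j`
belongs to the set, and is `n + 1` for an empty column. -/
theorem IsUpperSet.exists_staircase {n : ℕ} {S : Finset (Fin n × Fin n)}
    (hS : IsUpperSet (S : Set (Fin n × Fin n))) :
    ∃ r : ℕ → ℕ, (∀ k, 1 ≤ r k) ∧ (∀ k, r k ≤ n + 1) ∧ AntitoneOn r (Set.Icc 1 n) ∧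
      S = staircase n r := by
  let Q (k q : ℕ) : Prop := 1 ≤ q ∧ ∀ i j : Fin n, (j : ℕ) + 1 = k → q ≤ (i : ℕ) + 1 → (i, j) ∈ S
  have hQ : ∀ k, Q k (n + 1) := fun k => ⟨by omega, fun i j _ h => by omega⟩
  classical
  refine ⟨fun k => Nat.find ⟨n + 1, hQ k⟩, fun k => (Nat.find_spec ⟨n + 1, hQ k⟩).1,
    fun k => Nat.find_min' _ (hQ k), fun k hk l hl hkl => Nat.find_min' _ ⟨?_, ?_⟩, ?_⟩
  · exact (Nat.find_spec ⟨n + 1, hQ k⟩).1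
  · intro i j hj hi
    have hk1 := hk.1
    have hjn := j.2
    have := (Nat.find_spec ⟨n + 1, hQ k⟩).2 i ⟨k - 1, by omega⟩ (by simp only; omega) hi
    exact hS (Prod.mk_le_mk.2 ⟨le_rfl, Fin.le_def.2 (by simp only; omega)⟩) this
  · ext ⟨i, j⟩
    rw [mem_staircase]
    constructor
    · intro h
      refine Nat.find_min' _ ⟨by simp only; omega, fun i' j' hj hi => ?_⟩
      obtain rfl : j' = j := Fin.ext (by simp only at hj; omega)
      exact hS (Prod.mk_le_mk.2 ⟨Fin.le_def.2 (by simp only at hi; omega), le_rfl⟩) h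
    · intro h
      exact (Nat.find_spec ⟨n + 1, hQ (j + 1)⟩).2 i j rfl h

/-- Ties among the products `α i * α j` can be broken so that the smallest ones form an upper set. -/
theorem exists_isUpperSet_isBottom {n : ℕ} {α : Fin n → ℝ} (hα : Antitone α) (h0 : ∀ i, 0 ≤ α i)
    (S : Finset (Fin n × Fin n)) : ∃ T : Finset (Fin n × Fin n), T.card = S.card ∧
      IsUpperSet (T : Set (Fin n × Fin n)) ∧ IsBottom (fun s => α s.1 * α s.2) T := by
  obtain ⟨T, hT, hkey⟩ := exists_card_eq_key_le
    (fun s : Fin n × Fin n => toLex (α s.1 * α s.2, -((s.1 : ℤ) + s.2))) S.card S.card_le_univ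
  refine ⟨T, hT, fun s t hst hs => ?_, fun s hs t ht => ?_⟩
  · by_contra ht
    have h := hkey s hs t ht
    have h1 : α t.1 * α t.2 ≤ α s.1 * α s.2 :=
      mul_le_mul (hα hst.1) (hα hst.2) (h0 _) (h0 _)
    rw [Prod.Lex.toLex_le_toLex] at h
    rcases h with h | ⟨-, h⟩
    · exact absurd h h1.not_gt
    · have h3 := Fin.le_def.1 hst.1
      have h4 := Fin.le_def.1 hst.2
      simp only at h
      refine ht (?_ : t ∈ (T : Set _))
      have : t = s := Prod.ext (Fin.ext (by omega)) (Fin.ext (by omega))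
      rwa [this]
  · have h := hkey s hs t ht
    rw [Prod.Lex.toLex_le_toLex] at h
    rcases h with h | ⟨h, -⟩
    exacts [h.le, h.le]

theorem isBottom_of_forall_sum_le {ι : Type*} [DecidableEq ι] {w : ι → ℝ} {S : Finset ι}
    (h : ∀ T : Finset ι, T.card = S.card → ∑ s ∈ S, w s ≤ ∑ s ∈ T, w s) : IsBottom w S := by
  intro s hs t ht
  have ht' : t ∉ S.erase s := fun h => ht (Finset.mem_of_mem_erase h)
  have := h (insert t (S.erase s)) (by
    rw [Finset.card_insert_of_notMem ht', Finset.card_erase_add_one hs])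
  rw [Finset.sum_insert ht', ← Finset.add_sum_erase S w hs] at this
  linarith

/-! ### Self-catalysis -/

theorem mainTheorem1 {a b c d n : ℕ}
    (ψ : Matrix (Fin a) (Fin b) ℂ) (φ : Matrix (Fin c) (Fin d) ℂ) (α β : Fin n → ℝ)
    (hα : IsSchmidtVector ψ α) (hβ : IsSchmidtVector φ β) (hβn : 0 < entry β n)
    (hP : sloccProb ψ φ < min (entry α n / entry β n) 1)
    (L : Set ℕ)
    (hL : L = {l | 1 < l ∧ l < n ∧ sloccProb ψ φ = tailSum α l / tailSum β l}) :
    sloccProb (tensorState ψ ψ) (tensorState φ ψ) > sloccProb ψ φ ↔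
      ∀ r : ℕ → ℕ, (∀ i ∈ Set.Icc 1 n, r i ∈ L ∪ {n + 1}) → AntitoneOn r (Set.Icc 1 n) →
        r n ≠ n + 1 →
        ∃ i j : ℕ, 1 ≤ j ∧ j < i ∧ i ≤ n ∧
          ((r j ≠ n + 1 ∧
              entry α i / entry α j < entry β (r j) / entry β (r i - 1)) ∨
            (r i ≠ n + 1 ∧
              entry α i / entry α j > entry β (r j - 1) / entry β (r i))) := by
  have hn : 1 ≤ n := by
    by_contra h
    simp [entry, show n = 0 by omega] at hβn
  have hP0 := sloccProb_nonneg ψ φ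
  obtain ⟨hPn, hP1⟩ := lt_min_iff.1 hP
  have hαn : 0 < entry α n := by
    have := hP0.trans_lt hPn
    by_contra! h
    exact absurd this (div_nonpos_of_nonpos_of_nonneg h hβn.le).not_gt
  have hαpos := pos_of_entry_pos hα.antitone hαn
  have hβpos := pos_of_entry_pos hβ.antitone hβn
  have hα0 := hα.nonneg
  have hle : ∀ k, 1 ≤ k → k ≤ n + 1 → sloccProb ψ φ * tailSum β k ≤ tailSum α k := by
    intro k h1 hk
    rcases Nat.lt_or_eq_of_le hk with hk | rfl
    · exact sloccProb_mul_tailSum_le hα hβ hβpos h1 (by omega)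
    · rw [tailSum_add_one hα.sum_eq_one, tailSum_add_one hβ.sum_eq_one, mul_zero]
  set P := sloccProb ψ φ
  have : Nonempty (Fin n × Fin n) := ⟨(⟨0, hn⟩, ⟨0, hn⟩)⟩
  have hiff := lt_sloccProb_iff (hα.hasSchmidtWeights.tensorState hα.hasSchmidtWeights)
    (hβ.hasSchmidtWeights.tensorState hα.hasSchmidtWeights)
    (by rw [Fintype.sum_prod_type, ← Finset.sum_mul_sum, hα.sum_eq_one, hβ.sum_eq_one, mul_one])
    (fun s => mul_pos (hβpos s.1) (hαpos s.2)) hP0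
  rw [gt_iff_lt, hiff]
  constructor
  · intro h r hrL _ hrn
    by_contra! hcon
    have hmem : ∀ j, 1 ≤ j → j ≤ n → (1 < r j ∧ r j < n ∧ tailSum α (r j) = P * tailSum β (r j)) ∨
        r j = n + 1 := by
      intro j h1 hj
      rcases hrL j ⟨h1, hj⟩ with h | h
      · rw [hL] at h
        refine .inl ⟨h.1, h.2.1, ?_⟩
        rw [h.2.2, div_mul_cancel₀ _ (tailSum_pos hβ.sum_eq_one hβpos h.1.le h.2.1.le).ne']
      · exact .inr h
    -- the failure of both alternatives compares the corners of any two columns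
    have hB : IsBottom (fun s : Fin n × Fin n => β s.1 * α s.2) (staircase n r) := by
      refine isBottom_staircase hβ.antitone hα0 (fun j j' hj hj1 hj2 => ?_)
        (fun j => ?_) (fun j => ?_)
      · rw [← entry_val_add_one α j, ← entry_val_add_one α j']
        have hj3 : 1 < r (j + 1) := by
          have := hmem (j + 1) (by omega) j.2
          omega
        have p1 := entry_pos hαpos (Nat.le_add_left 1 _) j.2
        have p2 := entry_pos hαpos (Nat.le_add_left 1 _) j'.2
        have p3 := entry_pos hβpos hj3.le hj
        have p4 := entry_pos hβpos (k := r (j' + 1) - 1) (by omega) (by omega)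
        rcases lt_trichotomy j j' with hlt | rfl | hlt
        · have := (hcon (j' + 1) (j + 1) (by omega) (by have := Fin.lt_def.1 hlt; omega)
            j'.2).1 (by omega)
          rw [div_le_div_iff₀ p4 p1] at this
          linarith
        · exact mul_le_mul_of_nonneg_right
            (entry_le_of_antitone hβ.antitone (by omega) (by omega) hj) p1.le
        · have := (hcon (j + 1) (j' + 1) (by omega) (by have := Fin.lt_def.1 hlt; omega)
            j.2).2 (by omega)
          rw [div_le_div_iff₀ p2 p3] at this
          linarith
      · have := hmem (j + 1) (by omega) j.2
        omega
      · have := hmem (j + 1) (by omega) j.2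
        omega
    obtain ⟨T, hT, hlt⟩ := h (staircase n r) ⟨(⟨n - 1, by omega⟩, ⟨n - 1, by omega⟩), by
      rw [mem_staircase]
      have := hmem n hn le_rfl
      simp only [Nat.sub_add_cancel hn]
      omega⟩
    have h1 := mul_le_mul_of_nonneg_left
      (hB.sum_le_sum (fun s => mul_nonneg (hβ.nonneg _) (hα0 _)) hT.symm) hP0
    rw [sum_staircase hβ.sum_eq_one, Finset.mul_sum] at h1
    rw [sum_staircase hα.sum_eq_one] at hlt
    refine (h1.trans_lt hlt).ne (Finset.sum_congr rfl fun j _ => ?_)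
    rcases hmem (j + 1) (by omega) j.2 with h | h
    · rw [h.2.2]; ring
    · rw [h, tailSum_add_one hα.sum_eq_one, tailSum_add_one hβ.sum_eq_one]; ring
  · intro h
    by_contra! hcon
    obtain ⟨S₀, hS₀, hcon⟩ := hcon
    obtain ⟨S, hSc, hup, hSB⟩ := exists_isUpperSet_isBottom hα.antitone hα0 S₀
    have hSw : ∀ T : Finset (Fin n × Fin n), T.card = S.card →
        ∑ s ∈ S, α s.1 * α s.2 ≤ P * ∑ s ∈ T, β s.1 * α s.2 := fun T hT =>
      (hSB.sum_le_sum (fun s => mul_nonneg (hα0 _) (hα0 _)) hSc).trans (hcon T (hT.trans hSc))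
    obtain ⟨r, hr1, hr2, hanti, rfl⟩ := IsUpperSet.exists_staircase hup
    have hSne : (staircase n r).Nonempty := by rwa [← Finset.card_pos, hSc, Finset.card_pos]
    have hPpos : 0 < P := by
      refine hP0.lt_of_ne fun h0 => ?_
      have := hSw _ rfl
      rw [← h0, zero_mul] at this
      exact absurd this (Finset.sum_pos (fun s _ => mul_pos (hαpos _) (hαpos _)) hSne).not_ge
    -- each column satisfies the inequality of the untensored vectors, hence all are tight
    have hterm : ∀ j : Fin n, α j * (P * tailSum β (r (j + 1))) ≤ α j * tailSum α (r (j + 1)) :=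
      fun j => mul_le_mul_of_nonneg_left (hle _ (hr1 _) (hr2 _)) (hα0 j)
    have hsum : ∑ j : Fin n, α j * tailSum α (r (j + 1)) =
        ∑ j : Fin n, α j * (P * tailSum β (r (j + 1))) := by
      refine le_antisymm ?_ (Finset.sum_le_sum fun j _ => hterm j)
      have := hSw _ rfl
      rw [sum_staircase hα.sum_eq_one, sum_staircase hβ.sum_eq_one, Finset.mul_sum] at this
      refine this.trans_eq (Finset.sum_congr rfl fun j _ => by ring)
    have htight : ∀ j : Fin n, tailSum α (r (j + 1)) = P * tailSum β (r (j + 1)) := fun j =>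
      mul_left_cancel₀ (hαpos j).ne'
        ((Finset.sum_eq_sum_iff_of_le fun j _ => hterm j).1 hsum.symm j (Finset.mem_univ j)).symm
    have hrL : ∀ i ∈ Set.Icc 1 n, r i ∈ L ∪ {n + 1} := by
      intro i hi
      have ht := htight ⟨i - 1, by have := hi.1; have := hi.2; omega⟩
      simp only [Nat.sub_add_cancel hi.1] at ht
      by_cases hin : r i = n + 1
      · exact .inr hin
      have hin' : r i ≤ n := by have := hr2 i; omega
      have hpos := tailSum_pos hβ.sum_eq_one hβpos (hr1 i) hin'
      have hq : P = tailSum α (r i) / tailSum β (r i) := by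
        rw [ht, mul_div_cancel_right₀ _ hpos.ne']
      rw [hL]
      refine .inl ⟨lt_of_le_of_ne (hr1 i) fun h1 => ?_, lt_of_le_of_ne hin' fun h1 => ?_, hq⟩
      · rw [← h1] at hq
        simp only [tailSum, Finset.Ico_self, Finset.sum_empty, sub_zero, div_one] at hq
        exact hP1.ne hq
      · rw [h1, tailSum_last hα.sum_eq_one hn, tailSum_last hβ.sum_eq_one hn] at hq
        exact hPn.ne hq
    have hrn : r n ≠ n + 1 := by
      obtain ⟨⟨i, j⟩, hij⟩ := hSne
      rw [mem_staircase] at hij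
      simp only at hij
      have := hanti (a := (j : ℕ) + 1) (b := n) ⟨by omega, j.2⟩ ⟨hn, le_rfl⟩ j.2
      omega
    have hr3 : ∀ i, 1 ≤ i → i ≤ n → 2 ≤ r i := by
      intro i h1 hi
      rcases hrL i ⟨h1, hi⟩ with h | h
      · rw [hL] at h; exact h.1
      · have : r i = n + 1 := h
        omega
    -- a set of smaller products of the same size would violate the choice of the staircase
    have hB : IsBottom (fun s : Fin n × Fin n => β s.1 * α s.2) (staircase n r) := by
      refine isBottom_of_forall_sum_le fun T hT => le_of_mul_le_mul_left ?_ hPpos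
      refine le_trans (le_of_eq ?_) (hSw T hT)
      rw [sum_staircase hα.sum_eq_one, sum_staircase hβ.sum_eq_one, hsum, Finset.mul_sum]
      exact Finset.sum_congr rfl fun j _ => by ring
    have hcol : ∀ j j', 1 ≤ j → j ≤ n → 1 ≤ j' → j' ≤ n → r j ≠ n + 1 →
        entry β (r j) * entry α j ≤ entry β (r j' - 1) * entry α j' := by
      intro j j' hj hjn hj' hjn' hne
      have e1 := hr2 j
      have e2 := hr2 j'
      have e3 := hr3 j hj hjn
      have e4 := hr3 j' hj' hjn'
      have := hB (⟨r j - 1, by omega⟩, ⟨j - 1, by omega⟩)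
        (by rw [mem_staircase]; simp only [Nat.sub_add_cancel hj]; omega)
        (⟨r j' - 1 - 1, by omega⟩, ⟨j' - 1, by omega⟩)
        (by rw [mem_staircase]; simp only [Nat.sub_add_cancel hj']; omega)
      unfold entry
      rw [dif_pos ⟨by omega, by omega⟩, dif_pos ⟨by omega, by omega⟩, dif_pos ⟨by omega, by omega⟩,
        dif_pos ⟨by omega, by omega⟩]
      exact this
    obtain ⟨i, j, hj, hji, hi, hor⟩ := h r hrL hanti hrn
    have e1 := hr2 i
    have e2 := hr2 j
    have e3 := hr3 i (by omega) hi
    have e4 := hr3 j hj (by omega)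
    have p1 := entry_pos hαpos hj (by omega)
    have p2 := entry_pos hαpos (k := i) (by omega) hi
    rcases hor with ⟨hne, hlt⟩ | ⟨hne, hlt⟩
    · rw [div_lt_div_iff₀ p1 (entry_pos hβpos (by omega) (by omega))] at hlt
      have := hcol j i hj (by omega) (by omega) hi hne
      linarith
    · rw [gt_iff_lt, div_lt_div_iff₀ (entry_pos hβpos (by omega) (by omega)) p1] at hlt
      have := hcol i j (by omega) hi hj (by omega) hne
      linarith
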